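/- **Setting.** For finite sets $\mathcal X,\mathcal A$, a discounted linear MDP $\mathcal M$ has a transition kernel $P$, an initial distribution $\nu_0$, a discount factor $\gamma\in(0,1)$, feature maps $\phi_r:\mathcal X\times\mathcal A\to\mathbb R^{d_r}$ and $\phi_P:\mathcal X\times\mathcal A\to\mathbb R^{d_P}$, a vector $w$ and a map $m$ with $P(x'\mid x,a)=\langle\phi_P(x,a),m(x')\rangle$ and $r(x,a)=\langle\phi_r(x,a),w\rangle\in[0,1]$; its dimension is $d=d_r+d_P$. For a stationary policy $\pi$, $V_{\mathcal M}^\pi(x)=\mathbb E_\pi[\sum_{t\ge 0}\gamma^t r(X_t,A_t)\mid X_0=x]$, the occupancy measure is $\mu_{\mathcal M}(\pi)(x,a)=(1-\gamma)\sum_{t\ge0}\gamma^t\Pr_\pi[X_t=x,A_t=a]$ with $X_0\sim\nu_0$, and the feature expectation is $\lambda_{\mathcal M}(\pi)=\sum_{x,a}\mu_{\mathcal M}(\pi)(x,a)\,\phi_r(x,a)$. An imitation-from-features algorithm $\mathrm{Alg}$ (possibly randomized) receives $\phi_r$, $\phi_P$, the reward class $\{(x,a)\mapsto\langle\phi_r(x,a),w'\rangle:\|w'\|\le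 1\}$ (which contains the true reward) and the exact expert feature expectation $\lambda_{\mathcal M}(\pi_E)$, but neither $P$, nor $r$, nor $\pi_E$. It collects $K$ trajectories: each starts from $\nu_0$, in each step the learner sees the current state, chooses an action adaptively from everything observed so far and sees the next state drawn from $P$, and after each step the trajectory ends with probability $1-\gamma$ independently of everything else. Rewards are not observed. It then outputs a (random) stationary policy $\pi^{\mathrm{out}}$. **Theorem (lower bound on $K$).** For all $\gamma_0>0$ and $C>0$ there are constants $c>0$ and $\varepsilon_0>0$, depending only on $\gamma_0$ and $C$, such that the following holds for every finite action set $\mathcal A$ with $|\mathcal A|\ge2$, every $\gamma\in[\gamma_0,1)$, every $0<\varepsilon\le\varepsilon_0/(1-\gamma)$ and every $K\in\mathbb N$. Put $d=2+2|\mathcal A|$. If $$K<\frac{c\,d}{(1-\gamma)^2\varepsilon^2},$$ then for every imitation-from-features algorithm $\mathrm{Alg}$ that collects $K$ trajectories there exist a linear MDP $\mathcal M$ with two states, action set $\mathcal A$, discount factor $\gamma$ and dimension $d$ (with $d_r=2$, $\phi_r(x,a)=\mathbf e_x$, $d_P=2|\mathcal A|$, $\|\phi_P(x,a)\|\le1$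 for all $x,a$, and $\|w\|\le1$) and an expert policy $\pi_E$ such that $$\mathbb E_{\mathrm{Alg}}\big[\langle\nu_0,V_{\mathcal M}^{\pi_E}-V_{\mathcal M}^{\pi^{\mathrm{out}}}\rangle\big]>C\varepsilon .$$ That is, guaranteeing expected suboptimality $O(\varepsilon)$ requires $K=\Omega\big(d/((1-\gamma)^2\varepsilon^2)\big)$ trajectories. -/

import Mathlib

namespace FeatureImitation

open MeasureTheory

noncomputable section

/-- A stationary state-feedback policy. -/
abbrev Policy (X A : Type*) := X → PMF A

/-- A discounted linear MDP with finitely many states and actions, whose mean reward is linear in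
the feature map `φr` (dimension `dr`) and whose transition kernel is linear in the feature map `φP`
(dimension `dP`).  It is a linear MDP of dimension `dr + dP` for the concatenated features. -/
structure LinearMDP (X A : Type*) (dr dP : ℕ) where
  /-- transition kernel -/
  P : X → A → PMF X
  /-- initial-state distribution -/
  ν₀ : PMF X
  /-- discount factor -/
  γ : ℝ
  γ_pos : 0 < γ
  γ_lt_one : γ < 1
  /-- reward features -/
  φr : X → A → EuclideanSpace ℝ (Fin dr)
  /-- transition features -/
  φP : X → A → EuclideanSpace ℝ (Fin dP)
  /-- true reward weights -/
  w : EuclideanSpace ℝ (Fin dr)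
  /-- transition weights -/
  m : X → EuclideanSpace ℝ (Fin dP)
  P_eq : ∀ x a x', (P x a x').toReal = inner ℝ (φP x a) (m x')
  reward_mem : ∀ x a, inner ℝ (φr x a) w ∈ Set.Icc (0 : ℝ) 1

/-- The class of the rewards `Φ_r w` with `‖w‖ ≤ W`. -/
def rewardClass {X A : Type*} {dr : ℕ} (φr : X → A → EuclideanSpace ℝ (Fin dr)) (W : ℝ) :
    Set (X → A → ℝ) :=
  {r | ∃ w : EuclideanSpace ℝ (Fin dr), ‖w‖ ≤ W ∧ r = fun x a => inner ℝ (φr x a) w}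

/-- The law of the number of transitions after the first one in an episode in which, after each
transition, the process continues with probability `γ` and is reset with probability `1 - γ`. -/
def continuations (γ : ℝ) (h0 : 0 < γ) (h1 : γ < 1) : PMF ℕ :=
  ⟨fun n => ENNReal.ofReal ((1 - γ) * γ ^ n), by
    have hs : HasSum (fun n : ℕ => (1 - γ) * γ ^ n) 1 := by
      have h := (hasSum_geometric_of_lt_one h0.le h1).mul_left (1 - γ)
      rwa [mul_inv_cancel₀ (by linarith)] at h
    have hn : ∀ n : ℕ, 0 ≤ (1 - γ) * γ ^ n := fun n =>
      mul_nonneg (by linarith) (pow_nonneg h0.le n)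
    have he := ENNReal.ofReal_tsum_of_nonneg hn hs.summable
    rw [hs.tsum_eq, ENNReal.ofReal_one] at he
    rw [he]
    exact ENNReal.summable.hasSum⟩

namespace LinearMDP

variable {X A : Type*} {dr dP : ℕ} (M : LinearMDP X A dr dP)

/-- The true (mean) reward function. -/
def reward (x : X) (a : A) : ℝ := inner ℝ (M.φr x a) M.w

/-- The law of `X_t` under the policy `π` when `X_0 ∼ ν`. -/
def stateLaw (π : Policy X A) (ν : PMF X) : ℕ → PMF X
  | 0 => ν
  | t + 1 => (stateLaw π ν t).bind fun x => (π x).bind fun a => M.P x a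

/-- `Pr[X_t = x, A_t = a]` under the policy `π` when `X_0 ∼ ν`. -/
def stateActionProb (π : Policy X A) (ν : PMF X) (t : ℕ) (x : X) (a : A) : ℝ :=
  (M.stateLaw π ν t x).toReal * (π x a).toReal

variable [Fintype X] [Fintype A]

/-- The value function `V^π(x) = E[∑_t γ^t r(X_t, A_t) | X_0 = x]` for the true reward. -/
def value (π : Policy X A) (x : X) : ℝ :=
  ∑' t : ℕ, M.γ ^ t * ∑ y : X, ∑ a : A, M.stateActionProb π (PMF.pure x) t y a * M.reward y a

/-- `⟨ν₀, V^π⟩`. -/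
def initialValue (π : Policy X A) : ℝ := ∑ x : X, (M.ν₀ x).toReal * M.value π x

/-- `⟨ν₀, V^{πE} - V^π⟩`. -/
def suboptimality (πE π : Policy X A) : ℝ := M.initialValue πE - M.initialValue π

/-- The state-action occupancy measure `μ(π)`. -/
def occupancy (π : Policy X A) (x : X) (a : A) : ℝ :=
  (1 - M.γ) * ∑' t : ℕ, M.γ ^ t * M.stateActionProb π M.ν₀ t x a

/-- The feature expectation `λ(π) = Φ_rᵀ μ(π)`. -/
def featureExpectation (π : Policy X A) : EuclideanSpace ℝ (Fin dr) :=
  ∑ x : X, ∑ a : A, M.occupancy π x a • M.φr x a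

end LinearMDP

/-- An observed transition `(X_t, A_t, X'_{t+1})`. -/
abbrev Transition (X A : Type*) := X × A × X

/-- The transitions of one episode, in order. -/
abbrev Trajectory (X A : Type*) := List (Transition X A)

/-- What the learner is told before it interacts: the feature maps, a class that contains the true
reward, and the exact feature expectation of the expert. -/
structure LearnerInput (X A : Type*) (dr dP : ℕ) where
  φr : X → A → EuclideanSpace ℝ (Fin dr)
  φP : X → A → EuclideanSpace ℝ (Fin dP)
  rewards : Set (X → A → ℝ)
  expertFeatures : EuclideanSpace ℝ (Fin dr)

/-- A (possibly randomized, adaptive) imitation-from-features algorithm.  All its randomness is in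
the seed `ω`, which is drawn independently of the environment.  Given its input and the seed, the
next action depends on the completed episodes, the transitions of the current episode and the
current state; the output policy depends on all the collected trajectories. -/
structure Algorithm (Ω X A : Type*) [MeasurableSpace Ω] (dr dP : ℕ) where
  seed : Measure Ω
  isProbabilityMeasure_seed : IsProbabilityMeasure seed
  act : LearnerInput X A dr dP → Ω → List (Trajectory X A) → Trajectory X A → X → A
  out : LearnerInput X A dr dP → Ω → List (Trajectory X A) → Policy X A
  measurableSet_act : ∀ I D h x a, MeasurableSet {ω | act I ω D h x = a}
  measurable_out : ∀ I D x a, Measurable fun ω => out I ω D x a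

namespace LinearMDP

variable {X A : Type*} {dr dP : ℕ} (M : LinearMDP X A dr dP)

/-- The law of the trajectory obtained from the partial trajectory `h` by playing `n` further steps
from the state `x` with the action rule `act`. -/
def rollout (act : Trajectory X A → X → A) : ℕ → Trajectory X A → X → PMF (Trajectory X A)
  | 0, h, _ => PMF.pure h
  | n + 1, h, x =>
      (M.P x (act h x)).bind fun y => rollout act n (h ++ [(x, act h x, y)]) y

/-- The law of one episode: it starts from `ν₀` and has a geometric number of transitions, with
mean `1 / (1 - γ)`, which the action rule does not see in advance. -/
def episode (act : Trajectory X A → X → A) : PMF (Trajectory X A) :=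
  M.ν₀.bind fun x =>
    (continuations M.γ M.γ_pos M.γ_lt_one).bind fun n => M.rollout act (n + 1) [] x

/-- The law of the list of the first `K` trajectories. -/
def dataset (act : List (Trajectory X A) → Trajectory X A → X → A) :
    ℕ → PMF (List (Trajectory X A))
  | 0 => PMF.pure []
  | k + 1 => (dataset act k).bind fun D => (M.episode (act D)).map fun τ => D ++ [τ]

variable [Fintype X] [Fintype A]

/-- The learner's input for the expert `πE` and the rewards `Φ_r w` with `‖w‖ ≤ W`. -/
def learnerInput (W : ℝ) (πE : Policy X A) : LearnerInput X A dr dP where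
  φr := M.φr
  φP := M.φP
  rewards := rewardClass M.φr W
  expertFeatures := M.featureExpectation πE

/-- `E_Alg[⟨ν₀, V^{πE} - V^{πout}⟩]`, where `πout` is the output of the algorithm after `K`
trajectories; the expectation is over the seed and the trajectories. -/
def expectedSuboptimality {Ω : Type*} [MeasurableSpace Ω] (alg : Algorithm Ω X A dr dP)
    (W : ℝ) (K : ℕ) (πE : Policy X A) : ℝ :=
  ∫ ω, ∑' D : List (Trajectory X A),
    (M.dataset (alg.act (M.learnerInput W πE) ω) K D).toReal *
      M.suboptimality πE (alg.out (M.learnerInput W πE) ω D) ∂alg.seed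

end LinearMDP

end

end FeatureImitation

namespace FeatureImitation

open MeasureTheory
open scoped ENNReal NNReal

noncomputable section

/-! The proof hides one good action among `|A|`. State `0` is absorbing and has reward one; state
`1`, the start, has reward zero. Every action escapes from `1` with probability `(1 - γ) / 4`,
except one distinguished action, whose probability is larger by a factor `1 + δ`. The expert plays
the distinguished action. As the reward features ignore actions, its feature expectation is the same
wherever that action sits (`learnerInput_escapeMDP_eq`), so the learner must find it by exploring.

A policy that plays it with probability `q` in state `1` loses at least of order `δ (1 - q) / (1 -
γ)` (`suboptimality_escapeMDP_bounds`). Each trial of an action in state `1` carries relative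
entropy of order `(1 - γ) δ²` about whether it is distinguished, and `K` trajectories have `K / (1 -
γ)` transitions on average. Hence the total information is of order `δ² K`, shared among `|A|`
hypotheses. When it is small against `|A|`, comparison with the environment without a distinguished
action (`LinearMDP.expect_dataset_le_add`) bounds the average of `q` by `3 / 4`
(`sum_expect_le_of_few_trajectories`). Averaging over actions selects a bad environment, and `δ`
proportional to `ε (1 - γ)` gives the rate. -/

/-- The expectation of a nonnegative function under a probability mass function. -/
def expect {α : Type*} (p : PMF α) (F : α → ℝ≥0∞) : ℝ≥0∞ := ∑' x, p x * F x

/-! ### Calculus of expectations in `ℝ≥0∞` -/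

section Expect

variable {α β : Type*}

lemma expect_pure (x : α) (F : α → ℝ≥0∞) : expect (PMF.pure x) F = F x := by
  classical
  unfold expect
  rw [tsum_eq_single x]
  · simp
  · intro y hy
    simp [PMF.pure_apply, hy]

lemma expect_bind (p : PMF α) (f : α → PMF β) (F : β → ℝ≥0∞) :
    expect (p.bind f) F = expect p fun x => expect (f x) F := by
  unfold expect
  simp only [PMF.bind_apply, ← ENNReal.tsum_mul_right, ← ENNReal.tsum_mul_left]
  rw [ENNReal.tsum_comm]
  simp only [mul_assoc]

lemma expect_map (p : PMF α) (f : α → β) (F : β → ℝ≥0∞) :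
    expect (p.map f) F = expect p fun x => F (f x) := by
  rw [PMF.map, expect_bind]
  simp only [Function.comp, expect_pure]

lemma expect_const (p : PMF α) (c : ℝ≥0∞) : expect p (fun _ => c) = c := by
  rw [expect, ENNReal.tsum_mul_right, p.tsum_coe, one_mul]

lemma expect_add (p : PMF α) (F G : α → ℝ≥0∞) :
    expect p (fun x => F x + G x) = expect p F + expect p G := by
  simp only [expect, mul_add, ENNReal.tsum_add]

lemma expect_const_mul (p : PMF α) (c : ℝ≥0∞) (F : α → ℝ≥0∞) :
    expect p (fun x => c * F x) = c * expect p F := by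
  simp only [expect, ← ENNReal.tsum_mul_left, mul_left_comm]

lemma expect_mul_const (p : PMF α) (c : ℝ≥0∞) (F : α → ℝ≥0∞) :
    expect p (fun x => F x * c) = expect p F * c := by
  simp only [expect, ← ENNReal.tsum_mul_right, mul_assoc]

lemma expect_sum {ι : Type*} (p : PMF α) (s : Finset ι) (F : ι → α → ℝ≥0∞) :
    expect p (fun x => ∑ i ∈ s, F i x) = ∑ i ∈ s, expect p (F i) := by
  classical
  induction s using Finset.induction_on with
  | empty => simp [expect]
  | insert i s hi ih => simp only [Finset.sum_insert hi, expect_add, ih]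

lemma expect_mono (p : PMF α) {F G : α → ℝ≥0∞} (h : ∀ x, F x ≤ G x) :
    expect p F ≤ expect p G :=
  ENNReal.tsum_le_tsum fun x => mul_le_mul_right (h x) _

lemma measurable_expect {Ω : Type*} [MeasurableSpace Ω] [Countable α] (p : PMF α)
    {F : Ω → α → ℝ≥0∞} (hF : ∀ x, Measurable fun ω => F ω x) :
    Measurable fun ω => expect p (F ω) :=
  Measurable.tsum fun x => (hF x).const_mul _

/-- A measurable family of functions may be evaluated at a measurable choice of index. -/
lemma measurable_of_fibers {Ω : Type*} [MeasurableSpace Ω] [Countable α] {s : Ω → α}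
    (hs : ∀ a, MeasurableSet {ω | s ω = a}) {F : α → Ω → ℝ≥0∞} (hF : ∀ a, Measurable (F a)) :
    Measurable fun ω => F (s ω) ω := by
  intro S hS
  have : (fun ω => F (s ω) ω) ⁻¹' S = ⋃ a, {ω | s ω = a} ∩ F a ⁻¹' S := by
    ext ω
    simp
  rw [this]
  exact MeasurableSet.iUnion fun a => (hs a).inter (hF a hS)

end Expect

/-! ### Multiplicative and additive functionals of a dataset -/

section Paths

variable {X A : Type*}

/-- The product of the weights of the transitions of a dataset. -/
def dataProd (R : Transition X A → ℝ≥0∞) (D : List (Trajectory X A)) : ℝ≥0∞ :=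
  (D.map fun τ => (τ.map R).prod).prod

/-- The sum of the scores of the transitions of a dataset. -/
def dataSum (g : Transition X A → ℝ≥0∞) (D : List (Trajectory X A)) : ℝ≥0∞ :=
  (D.map fun τ => (τ.map g).sum).sum

lemma dataProd_append (R : Transition X A → ℝ≥0∞) (D : List (Trajectory X A))
    (τ : Trajectory X A) : dataProd R (D ++ [τ]) = dataProd R D * (τ.map R).prod := by
  simp [dataProd]

lemma dataSum_append (g : Transition X A → ℝ≥0∞) (D : List (Trajectory X A))
    (τ : Trajectory X A) : dataSum g (D ++ [τ]) = dataSum g D + (τ.map g).sum := by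
  simp [dataSum]

end Paths

namespace LinearMDP

variable {X A : Type*} {dr dP : ℕ} (M : LinearMDP X A dr dP)

lemma expect_dataset_succ (act : List (Trajectory X A) → Trajectory X A → X → A) (k : ℕ)
    (F : List (Trajectory X A) → ℝ≥0∞) :
    expect (M.dataset act (k + 1)) F =
      expect (M.dataset act k) fun D => expect (M.episode (act D)) fun τ => F (D ++ [τ]) := by
  simp only [dataset, expect_bind, expect_map]

lemma expect_rollout_succ (act : Trajectory X A → X → A) (n : ℕ) (h : Trajectory X A) (x : X)
    (F : Trajectory X A → ℝ≥0∞) :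
    expect (M.rollout act (n + 1) h x) F =
      expect (M.P x (act h x)) fun y =>
        expect (M.rollout act n (h ++ [(x, act h x, y)]) y) F := by
  rw [rollout, expect_bind]

lemma expect_episode (act : Trajectory X A → X → A) (F : Trajectory X A → ℝ≥0∞) :
    expect (M.episode act) F = expect M.ν₀ fun x =>
      expect (continuations M.γ M.γ_pos M.γ_lt_one) fun n =>
        expect (M.rollout act (n + 1) [] x) F := by
  simp only [episode, expect_bind]

/-! ### Change of measure between environments -/

section ChangeOfMeasure

variable {M} {M' : LinearMDP X A dr dP} {R : Transition X A → ℝ≥0∞}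

/-- Both environments face the same action rule, so their likelihood ratio is the product of the
transition ratios alone. The prefix `h` stays general, with its weight on the left, so that the
induction can extend it. -/
lemma expect_rollout_reweight (hP : ∀ x a y, M'.P x a y = M.P x a y * R (x, a, y))
    (act : Trajectory X A → X → A) (F : Trajectory X A → ℝ≥0∞) (n : ℕ) (h : Trajectory X A)
    (x : X) :
    (h.map R).prod * expect (M'.rollout act n h x) F =
      expect (M.rollout act n h x) fun τ => (τ.map R).prod * F τ := by
  induction n generalizing h x with
  | zero => simp only [rollout, expect_pure]
  | succ n ih =>
    rw [expect_rollout_succ, expect_rollout_succ, ← expect_const_mul]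
    refine tsum_congr fun y => ?_
    beta_reduce
    rw [← ih, hP]
    simp only [List.map_append, List.map_cons, List.map_nil, List.prod_append, List.prod_cons,
      List.prod_nil, mul_one]
    ring

lemma expect_episode_reweight (hγ : M'.γ = M.γ) (hν : M'.ν₀ = M.ν₀)
    (hP : ∀ x a y, M'.P x a y = M.P x a y * R (x, a, y))
    (act : Trajectory X A → X → A) (F : Trajectory X A → ℝ≥0∞) :
    expect (M'.episode act) F = expect (M.episode act) fun τ => (τ.map R).prod * F τ := by
  rw [expect_episode, expect_episode]
  simp only [hν, hγ, ← expect_rollout_reweight hP act F, List.map_nil, List.prod_nil, one_mul]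

lemma expect_dataset_reweight (hγ : M'.γ = M.γ) (hν : M'.ν₀ = M.ν₀)
    (hP : ∀ x a y, M'.P x a y = M.P x a y * R (x, a, y))
    (act : List (Trajectory X A) → Trajectory X A → X → A) (k : ℕ)
    (F : List (Trajectory X A) → ℝ≥0∞) :
    expect (M'.dataset act k) F = expect (M.dataset act k) fun D => dataProd R D * F D := by
  induction k generalizing F with
  | zero => simp [dataset, expect_pure, dataProd]
  | succ k ih =>
    rw [expect_dataset_succ, expect_dataset_succ, ih]
    simp only [expect_episode_reweight hγ hν hP, dataProd_append, mul_assoc, expect_const_mul]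

end ChangeOfMeasure

/-! ### Additive scores and episode lengths -/

section Scores

variable {u v : Transition X A → ℝ≥0∞}

/-- Tower property: a comparison of one-step conditional means survives adaptive choice of actions.
The prefix scores appear on opposite sides to avoid subtraction. -/
lemma expect_rollout_sum_le
    (huv : ∀ x a, expect (M.P x a) (fun y => u (x, a, y)) ≤
      expect (M.P x a) fun y => v (x, a, y))
    (hv : ∀ x a, expect (M.P x a) (fun y => v (x, a, y)) ≠ ∞)
    (act : Trajectory X A → X → A) (n : ℕ) (h : Trajectory X A) (x : X) :
    expect (M.rollout act n h x) (fun τ => (τ.map u).sum) + (h.map v).sum ≤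
      expect (M.rollout act n h x) (fun τ => (τ.map v).sum) + (h.map u).sum := by
  induction n generalizing h x with
  | zero => simp only [rollout, expect_pure, add_comm, le_refl]
  | succ n ih =>
    rw [expect_rollout_succ, expect_rollout_succ]
    have key := expect_mono (M.P x (act h x)) fun y => ih (h ++ [(x, act h x, y)]) y
    simp only [List.map_append, List.map_cons, List.map_nil, List.sum_append, List.sum_cons,
      List.sum_nil, add_zero, expect_add, expect_const] at key
    rw [← ENNReal.add_le_add_iff_right (hv x (act h x)), add_assoc]
    refine key.trans ?_
    rw [← add_assoc]
    gcongr
    exact huv x _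

lemma expect_dataset_sum_le
    (huv : ∀ x a, expect (M.P x a) (fun y => u (x, a, y)) ≤
      expect (M.P x a) fun y => v (x, a, y))
    (hv : ∀ x a, expect (M.P x a) (fun y => v (x, a, y)) ≠ ∞)
    (act : List (Trajectory X A) → Trajectory X A → X → A) (k : ℕ) :
    expect (M.dataset act k) (dataSum u) ≤ expect (M.dataset act k) (dataSum v) := by
  induction k with
  | zero => simp [dataset, expect_pure, dataSum]
  | succ k ih =>
    simp only [expect_dataset_succ, dataSum_append, expect_add, expect_const]
    refine add_le_add ih (expect_mono _ fun D => ?_)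
    rw [expect_episode, expect_episode]
    refine expect_mono _ fun x => expect_mono _ fun n => ?_
    simpa using M.expect_rollout_sum_le huv hv (act D) (n + 1) [] x

lemma expect_rollout_length (act : Trajectory X A → X → A) (n : ℕ) (h : Trajectory X A) (x : X) :
    expect (M.rollout act n h x) (fun τ => (τ.map fun _ => (1 : ℝ≥0∞)).sum) = h.length + n := by
  induction n generalizing h x with
  | zero => simp [rollout, expect_pure]
  | succ n ih =>
    rw [expect_rollout_succ]
    simp only [ih, List.length_append, List.length_cons, List.length_nil]
    rw [expect_const]
    push_cast
    ring

lemma expect_episode_length (act : Trajectory X A → X → A) :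
    expect (M.episode act) (fun τ => (τ.map fun _ => (1 : ℝ≥0∞)).sum) =
      ENNReal.ofReal (1 / (1 - M.γ)) := by
  have h0 := M.γ_pos
  have h1 := M.γ_lt_one
  simp only [expect_episode, expect_rollout_length, expect_const, List.length_nil, Nat.cast_zero,
    zero_add]
  -- The factor `n + 1` counts the first transition as well as the `n` continuations.
  have hs : HasSum (fun n : ℕ => (1 - M.γ) * M.γ ^ n * (n + 1)) (1 / (1 - M.γ)) := by
    have ha := hasSum_coe_mul_geometric_of_norm_lt_one (r := M.γ)
      (by rw [Real.norm_eq_abs, abs_of_pos h0]; exact h1)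
    have hb := hasSum_geometric_of_lt_one h0.le h1
    have hc := (ha.add hb).mul_left (1 - M.γ)
    have hne : 1 - M.γ ≠ 0 := by linarith
    have e : (1 - M.γ) * (M.γ / (1 - M.γ) ^ 2 + (1 - M.γ)⁻¹) = 1 / (1 - M.γ) := by
      field_simp
      ring
    rw [e] at hc
    exact hc.congr_fun fun n => by ring
  have hn : ∀ n : ℕ, 0 ≤ (1 - M.γ) * M.γ ^ n * (n + 1) := fun n => by
    have := pow_nonneg h0.le n
    have : 0 ≤ 1 - M.γ := by linarith
    positivity
  rw [← hs.tsum_eq, ENNReal.ofReal_tsum_of_nonneg hn hs.summable]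
  refine tsum_congr fun n => ?_
  have : 0 ≤ (1 - M.γ) * M.γ ^ n := mul_nonneg (by linarith) (pow_nonneg h0.le n)
  rw [ENNReal.ofReal_mul this]
  congr 1
  rw [show ((n : ℝ) + 1) = ((n + 1 : ℕ) : ℝ) by push_cast; ring, ENNReal.ofReal_natCast]

lemma expect_dataset_length (act : List (Trajectory X A) → Trajectory X A → X → A) (k : ℕ) :
    expect (M.dataset act k) (dataSum fun _ => (1 : ℝ≥0∞)) =
      k * ENNReal.ofReal (1 / (1 - M.γ)) := by
  induction k with
  | zero => simp [dataset, expect_pure, dataSum]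
  | succ k ih =>
    simp only [expect_dataset_succ, dataSum_append, expect_add, expect_const,
      expect_episode_length, ih]
    push_cast
    ring

end Scores

/-! ### Measurability in the seed -/

section Measurability

variable [Countable X] [Countable A] {Ω : Type*} [MeasurableSpace Ω]

lemma measurable_expect_rollout {act : Ω → Trajectory X A → X → A}
    (hact : ∀ h x a, MeasurableSet {ω | act ω h x = a}) {F : Ω → Trajectory X A → ℝ≥0∞}
    (hF : ∀ τ, Measurable fun ω => F ω τ) (n : ℕ) (h : Trajectory X A) (x : X) :
    Measurable fun ω => expect (M.rollout (act ω) n h x) (F ω) := by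
  induction n generalizing h x with
  | zero => simpa only [rollout, expect_pure] using hF h
  | succ n ih =>
    simp only [expect_rollout_succ]
    exact measurable_of_fibers (F := fun a ω => expect (M.P x a) fun y =>
      expect (M.rollout (act ω) n (h ++ [(x, a, y)]) y) (F ω)) (hact h x)
      fun a => measurable_expect _ fun y => ih _ y

lemma measurable_expect_dataset {act : Ω → List (Trajectory X A) → Trajectory X A → X → A}
    (hact : ∀ D h x a, MeasurableSet {ω | act ω D h x = a})
    {F : Ω → List (Trajectory X A) → ℝ≥0∞}
    (hF : ∀ D, Measurable fun ω => F ω D) (k : ℕ) :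
    Measurable fun ω => expect (M.dataset (act ω) k) (F ω) := by
  induction k generalizing F with
  | zero => simpa only [dataset, expect_pure] using hF []
  | succ k ih =>
    simp only [expect_dataset_succ]
    refine ih fun D => ?_
    simp only [expect_episode]
    exact measurable_expect _ fun x => measurable_expect _ fun n =>
      M.measurable_expect_rollout (hact D) (fun τ => hF (D ++ [τ])) _ _ _

end Measurability

end LinearMDP

/-! ### Pathwise bounds -/

section Paths

variable {X A : Type*}

lemma sum_dataSum_le {ι : Type*} (s : Finset ι) {g : ι → Transition X A → ℝ≥0∞} {c : ℝ≥0∞}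
    (hg : ∀ tr, ∑ i ∈ s, g i tr ≤ c) (D : List (Trajectory X A)) :
    ∑ i ∈ s, dataSum (g i) D ≤ c * dataSum (fun _ => 1) D := by
  have inner (τ : Trajectory X A) :
      ∑ i ∈ s, (τ.map (g i)).sum ≤ c * (τ.map fun _ => (1 : ℝ≥0∞)).sum := by
    induction τ with
    | nil => simp
    | cons tr τ ih =>
      simp only [List.map_cons, List.sum_cons, Finset.sum_add_distrib, mul_add, mul_one]
      exact add_le_add (hg tr) ih
  induction D with
  | nil => simp [dataSum]
  | cons τ D ih =>
    simp only [dataSum, List.map_cons, List.sum_cons, Finset.sum_add_distrib, mul_add] at ih ⊢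
    exact add_le_add (inner τ) ih

/-- Lower bounds on log-likelihood ratios add up along the data. Their positive and negative parts
`u`, `v` are kept apart so that both sums live in `ℝ≥0∞`. -/
lemma exp_dataSum_le_dataProd {u v : Transition X A → ℝ≥0} {R : Transition X A → ℝ≥0∞}
    (hR : ∀ tr, ENNReal.ofReal (Real.exp (u tr - v tr)) ≤ R tr) (D : List (Trajectory X A)) :
    ∃ U V : ℝ≥0, dataSum (fun tr => u tr) D = U ∧ dataSum (fun tr => v tr) D = V ∧
      ENNReal.ofReal (Real.exp (U - V)) ≤ dataProd R D := by
  have split (a b c d : ℝ≥0) : ENNReal.ofReal (Real.exp (((a + b : ℝ≥0) : ℝ) - (c + d : ℝ≥0))) =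
      ENNReal.ofReal (Real.exp (a - c)) * ENNReal.ofReal (Real.exp (b - d)) := by
    rw [← ENNReal.ofReal_mul (Real.exp_pos _).le, ← Real.exp_add]
    push_cast
    congr 2
    ring
  have inner (τ : Trajectory X A) : ∃ U V : ℝ≥0, (τ.map fun tr => (u tr : ℝ≥0∞)).sum = U ∧
      (τ.map fun tr => (v tr : ℝ≥0∞)).sum = V ∧
      ENNReal.ofReal (Real.exp (U - V)) ≤ (τ.map R).prod := by
    induction τ with
    | nil => exact ⟨0, 0, by simp⟩
    | cons tr τ ih =>
      obtain ⟨U, V, hU, hV, h⟩ := ih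
      refine ⟨u tr + U, v tr + V, by simp [hU], by simp [hV], ?_⟩
      rw [split, List.map_cons, List.prod_cons]
      exact mul_le_mul' (hR tr) h
  induction D with
  | nil => exact ⟨0, 0, by simp [dataSum, dataProd]⟩
  | cons τ D ih =>
    obtain ⟨U, V, hU, hV, h⟩ := ih
    obtain ⟨U', V', hU', hV', h'⟩ := inner τ
    refine ⟨U' + U, V' + V, ?_, ?_, ?_⟩
    · rw [ENNReal.coe_add, ← hU, ← hU']
      simp [dataSum]
    · rw [ENNReal.coe_add, ← hV, ← hV']
      simp [dataSum]
    · rw [split]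
      simp only [dataProd, List.map_cons, List.prod_cons] at h ⊢
      exact mul_le_mul' h' h

end Paths

/-! ### Comparing two environments through relative entropy -/

/-- A pointwise form of Pinsker's inequality: a likelihood ratio `L` exceeds one by at most a
multiple of the integrand `L - 1 - log L` of the relative entropy and a multiple of `L + 1`. -/
lemma sub_one_mul_le_of_le_log {L f l : ℝ} (hL : 0 < L) (hf0 : 0 ≤ f) (hf1 : f ≤ 1)
    (hl : l ≤ Real.log L) : (L - 1) * f ≤ 8 * (L - 1 - l) + (L + 1) / 16 := by
  obtain ⟨z, hz, rfl⟩ : ∃ z : ℝ, 0 < z ∧ L = z ^ 2 :=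
    ⟨√L, Real.sqrt_pos.2 hL, (Real.sq_sqrt hL.le).symm⟩
  have hlog : l ≤ 2 * (z - 1) := by
    have := Real.log_le_sub_one_of_pos hz
    rw [Real.log_pow] at hl
    push_cast at hl
    linarith
  -- By `hlog`, `z ^ 2 - 1 - l ≥ (z - 1) ^ 2`. Then apply `a * b ≤ 8 * a ^ 2 + b ^ 2 / 32` with `a =
  -- z - 1`, `b = z + 1`, and `(z + 1) ^ 2 ≤ 2 * (z ^ 2 + 1)`.
  have hmain : z ^ 2 - 1 ≤ 8 * (z ^ 2 - 1 - l) + (z ^ 2 + 1) / 16 := by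
    nlinarith [sq_nonneg (16 * (z - 1) - (z + 1)), sq_nonneg (z - 1)]
  rcases le_total 1 (z ^ 2) with h | h
  · nlinarith
  · nlinarith [sq_nonneg (z - 1), sq_nonneg z]

/-- The preceding inequality with `l = U - V`, rearranged without subtraction; for `L = ∞` the right
side is infinite. -/
lemma ennreal_sub_one_mul_le {L f : ℝ≥0∞} {U V : ℝ≥0} (hf : f ≤ 1)
    (hL : ENNReal.ofReal (Real.exp (U - V)) ≤ L) :
    L * f + 8 * (1 + U) ≤ f + 8 * (L + V) + (L + 1) / 16 := by
  rcases eq_or_ne L ∞ with rfl | hLt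
  · simp
  lift L to ℝ≥0 using hLt
  lift f to ℝ≥0 using (hf.trans_lt ENNReal.one_lt_top).ne
  have hL' : Real.exp (U - V) ≤ L := by
    rwa [ENNReal.ofReal_le_coe] at hL
  have hLpos := (Real.exp_pos _).trans_le hL'
  have key := sub_one_mul_le_of_le_log hLpos (NNReal.coe_nonneg f) (by exact_mod_cast hf)
    ((Real.le_log_iff_exp_le hLpos).2 hL')
  have : L * f + 8 * (1 + U) ≤ f + 8 * (L + V) + (L + 1) / 16 := by
    rw [← NNReal.coe_le_coe]
    push_cast
    linarith
  rw [show (L : ℝ≥0∞) * f + 8 * (1 + U) = ((L * f + 8 * (1 + U) : ℝ≥0) : ℝ≥0∞) by push_cast; rfl,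
    show (f : ℝ≥0∞) + 8 * (L + V) + (L + 1) / 16 =
      ((f + 8 * (L + V) + (L + 1) / 16 : ℝ≥0) : ℝ≥0∞) by
        rw [ENNReal.coe_add, ENNReal.coe_div (by norm_num)]; push_cast; rfl]
  exact_mod_cast this

namespace LinearMDP

variable {X A : Type*} {dr dP : ℕ} {M M' : LinearMDP X A dr dP} {R : Transition X A → ℝ≥0∞}

/-- Two environments whose transition log-likelihood ratios have conditional mean at least `-w`
are hard to tell apart when the total expected `w` is small. -/
lemma expect_dataset_le_add (hγ : M'.γ = M.γ) (hν : M'.ν₀ = M.ν₀)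
    (hP : ∀ x a y, M'.P x a y = M.P x a y * R (x, a, y)) {u v : Transition X A → ℝ≥0}
    {w : Transition X A → ℝ≥0∞} (hR : ∀ tr, ENNReal.ofReal (Real.exp (u tr - v tr)) ≤ R tr)
    (huv : ∀ x a, expect (M.P x a) (fun y => (v (x, a, y) : ℝ≥0∞)) ≤
      expect (M.P x a) fun y => u (x, a, y) + w (x, a, y))
    (hfin : ∀ x a, expect (M.P x a) (fun y => u (x, a, y) + w (x, a, y)) ≠ ∞)
    (act : List (Trajectory X A) → Trajectory X A → X → A) (k : ℕ)
    (hU : expect (M.dataset act k) (dataSum fun tr => (u tr : ℝ≥0∞)) ≠ ∞)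
    {F : List (Trajectory X A) → ℝ≥0∞} (hF : ∀ D, F D ≤ 1) :
    expect (M'.dataset act k) F ≤
      expect (M.dataset act k) F + 1 / 8 + 8 * expect (M.dataset act k) (dataSum w) := by
  have hone : expect (M.dataset act k) (dataProd R) = 1 := by
    have := expect_dataset_reweight hγ hν hP act k fun _ => 1
    simpa only [mul_one, expect_const, eq_comm] using this
  have hV := M.expect_dataset_sum_le (u := fun tr => (v tr : ℝ≥0∞))
    (v := fun tr => (u tr : ℝ≥0∞) + w tr) huv hfin act k
  have hsplit : expect (M.dataset act k) (dataSum fun tr => (u tr : ℝ≥0∞) + w tr) =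
      expect (M.dataset act k) (dataSum fun tr => (u tr : ℝ≥0∞)) +
        expect (M.dataset act k) (dataSum w) := by
    rw [← expect_add]
    congr 1
    ext D
    simp only [dataSum, List.sum_map_add]
  have key := expect_mono (M.dataset act k) (F := fun D => dataProd R D * F D +
      8 * (1 + dataSum (fun tr => (u tr : ℝ≥0∞)) D))
    (G := fun D => F D + 8 * (dataProd R D + dataSum (fun tr => (v tr : ℝ≥0∞)) D) +
      (dataProd R D + 1) / 16) fun D => by
    obtain ⟨U, V, hU, hV, h⟩ := exp_dataSum_le_dataProd hR D
    rw [hU, hV]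
    exact ennreal_sub_one_mul_le (hF D) h
  simp only [div_eq_mul_inv, expect_add, expect_const_mul, expect_mul_const, expect_const, hone,
    ← expect_dataset_reweight hγ hν hP] at key
  rw [hsplit] at hV
  set EU := expect (M.dataset act k) (dataSum fun tr => (u tr : ℝ≥0∞))
  -- Finiteness of `EU` allows its cancellation, which leaves only the excess of `v` over `u`,
  -- bounded by `w`.
  have h8 : (8 : ℝ≥0∞) * (1 + EU) ≠ ∞ := by finiteness
  rw [← ENNReal.add_le_add_iff_right h8]
  refine key.trans ?_
  have e : (1 + 1 : ℝ≥0∞) * 16⁻¹ = 1 / 8 := by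
    rw [one_add_one_eq_two, show (16 : ℝ≥0∞) = 2 * 8 by norm_num,
      ENNReal.mul_inv (by norm_num) (by norm_num), ← mul_assoc,
      ENNReal.mul_inv_cancel (by norm_num) (by norm_num), one_mul, one_div]
  rw [e]
  calc _ ≤ expect (M.dataset act k) F + 8 * (1 + (EU + expect (M.dataset act k) (dataSum w))) +
        1 / 8 := by gcongr
    _ = _ := by ring

end LinearMDP

/-! ### The two-state environments -/

/-- The law on two states that gives mass `s` to the state `0`. -/
def coin (s : Set.Icc (0 : ℝ) 1) : PMF (Fin 2) :=
  PMF.ofFintype ![ENNReal.ofReal s, ENNReal.ofReal (1 - s)] (by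
    rw [Fin.sum_univ_two]
    simp only [Matrix.cons_val_zero, Matrix.cons_val_one]
    rw [← ENNReal.ofReal_add s.2.1 (by linarith [s.2.2])]
    simp)

lemma coin_one (s : Set.Icc (0 : ℝ) 1) : coin s 1 = ENNReal.ofReal (1 - s) := rfl

lemma expect_fin_two (p : PMF (Fin 2)) (F : Fin 2 → ℝ≥0∞) :
    expect p F = p 0 * F 0 + p 1 * F 1 := by
  rw [expect, tsum_fintype, Fin.sum_univ_two]

lemma toReal_add_toReal_eq_one (p : PMF (Fin 2)) : (p 0).toReal + (p 1).toReal = 1 := by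
  have h := p.tsum_coe
  rw [tsum_fintype, Fin.sum_univ_two] at h
  rw [← ENNReal.toReal_add (p.apply_ne_top 0) (p.apply_ne_top 1), h, ENNReal.toReal_one]

lemma sum_toReal_eq_one {A : Type*} [Fintype A] (p : PMF A) : ∑ a, (p a).toReal = 1 := by
  have h := p.tsum_coe
  rw [tsum_fintype] at h
  rw [← ENNReal.toReal_sum fun a _ => p.apply_ne_top a, h, ENNReal.toReal_one]

section Rates

variable {A : Type*}

/-- The escape probabilities that are `(1 - γ) / 4`, raised by the factor `1 + δ` at one
distinguished action, if there is one. -/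
def escapeRate (γ δ : ℝ) (h0 : 0 < γ) (h1 : γ < 1) (hδ : δ ∈ Set.Icc (0 : ℝ) 1) (o : Option A)
    (b : A) : Set.Icc (0 : ℝ) 1 :=
  open Classical in
  ⟨(1 - γ) / 4 * (1 + if o = some b then δ else 0), by
    obtain ⟨hd0, hd1⟩ := hδ
    split_ifs <;> constructor <;> nlinarith⟩

variable {γ δ : ℝ} {h0 : 0 < γ} {h1 : γ < 1} {hδ : δ ∈ Set.Icc (0 : ℝ) 1}

lemma escapeRate_none (b : A) :
    (escapeRate γ δ h0 h1 hδ none b : ℝ) = (1 - γ) / 4 := by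
  simp [escapeRate]

lemma escapeRate_some_self (a : A) :
    (escapeRate γ δ h0 h1 hδ (some a) a : ℝ) = (1 - γ) / 4 * (1 + δ) := by
  simp [escapeRate]

lemma escapeRate_some_of_ne {a b : A} (h : b ≠ a) :
    (escapeRate γ δ h0 h1 hδ (some a) b : ℝ) = (1 - γ) / 4 := by
  simp [escapeRate, h.symm]

end Rates

variable {A : Type*} [Fintype A]

/-- An enumeration of the state-action pairs of a two-state environment. -/
def pairIndex (A : Type*) [Fintype A] : Fin 2 × A ≃ Fin (2 * Fintype.card A) :=
  Fintype.equivFinOfCardEq (by simp)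

/-- The kernel of the two-state environment in which the state `0` is absorbing and the action `a`
leads from the state `1` to the state `0` with probability `s a`. -/
def escapeKernel (s : A → Set.Icc (0 : ℝ) 1) (x : Fin 2) (a : A) : PMF (Fin 2) :=
  if x = 0 then PMF.pure 0 else coin (s a)

/-- The linear MDP with the kernel `escapeKernel s`, started in the state `1`, with reward one in
the state `0` and reward zero in the state `1`. -/
def escapeMDP (γ : ℝ) (h0 : 0 < γ) (h1 : γ < 1) (s : A → Set.Icc (0 : ℝ) 1) :
    LinearMDP (Fin 2) A 2 (2 * Fintype.card A) where
  P := escapeKernel s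
  ν₀ := PMF.pure 1
  γ := γ
  γ_pos := h0
  γ_lt_one := h1
  φr x _ := EuclideanSpace.single x 1
  -- One-hot features represent every kernel, so they reveal nothing about `s`.
  φP x a := EuclideanSpace.single (pairIndex A (x, a)) 1
  w := EuclideanSpace.single 0 1
  m y := WithLp.toLp 2 fun i =>
    (escapeKernel s ((pairIndex A).symm i).1 ((pairIndex A).symm i).2 y).toReal
  P_eq x a y := by simp [EuclideanSpace.inner_single_left]
  reward_mem x a := by
    fin_cases x <;> simp [EuclideanSpace.inner_single_left]

/-! ### Values and feature expectations -/

section Value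

variable {γ : ℝ} {h0 : 0 < γ} {h1 : γ < 1} {s : A → Set.Icc (0 : ℝ) 1}

lemma escapeMDP_P_one_zero (a : A) :
    (escapeMDP γ h0 h1 s).P 1 a 0 = ENNReal.ofReal (s a) := rfl

lemma escapeMDP_P_one_one (a : A) :
    (escapeMDP γ h0 h1 s).P 1 a 1 = ENNReal.ofReal (1 - s a) := rfl

/-- The probability with which a policy stays in the state `1` for one more step. -/
def stayProb (s : A → Set.Icc (0 : ℝ) 1) (π : Policy (Fin 2) A) : ℝ :=
  ∑ a, (π 1 a).toReal * (1 - s a)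

lemma stayProb_nonneg (s : A → Set.Icc (0 : ℝ) 1) (π : Policy (Fin 2) A) : 0 ≤ stayProb s π :=
  Finset.sum_nonneg fun a _ => mul_nonneg ENNReal.toReal_nonneg (by linarith [(s a).2.2])

lemma stateLaw_one (π : Policy (Fin 2) A) (t : ℕ) :
    ((escapeMDP γ h0 h1 s).stateLaw π (PMF.pure 1) t 1).toReal = stayProb s π ^ t := by
  induction t with
  | zero => simp [LinearMDP.stateLaw]
  | succ t ih =>
    have hstep : (escapeMDP γ h0 h1 s).stateLaw π (PMF.pure 1) (t + 1) 1 =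
        (escapeMDP γ h0 h1 s).stateLaw π (PMF.pure 1) t 1 *
          ∑ a, π 1 a * ENNReal.ofReal (1 - s a) := by
      rw [LinearMDP.stateLaw, PMF.bind_apply, tsum_fintype, Fin.sum_univ_two]
      simp only [PMF.bind_apply, tsum_fintype, escapeMDP, escapeKernel, if_true, coin_one,
        one_ne_zero, if_false, PMF.pure_apply, mul_zero, Finset.sum_const_zero, zero_add]
    rw [hstep, ENNReal.toReal_mul, ih, pow_succ, stayProb, ENNReal.toReal_sum]
    · congr 1
      refine Finset.sum_congr rfl fun a _ => ?_
      rw [ENNReal.toReal_mul, ENNReal.toReal_ofReal (by linarith [(s a).2.2])]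
    · intro a _
      exact ENNReal.mul_ne_top ((π 1).apply_ne_top a) ENNReal.ofReal_ne_top

lemma stayProb_le_one (s : A → Set.Icc (0 : ℝ) 1) (π : Policy (Fin 2) A) : stayProb s π ≤ 1 := by
  rw [← sum_toReal_eq_one (π 1)]
  refine Finset.sum_le_sum fun a _ => ?_
  have := (s a).2.1
  exact mul_le_of_le_one_right ENNReal.toReal_nonneg (by linarith)

/-- The expected reward at time `t` is the probability of having escaped, `1 - stayProb s π ^ t`;
the value is a difference of two geometric series. -/
lemma initialValue_escapeMDP (π : Policy (Fin 2) A) :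
    (escapeMDP γ h0 h1 s).initialValue π = 1 / (1 - γ) - 1 / (1 - γ * stayProb s π) := by
  have hr0 := stayProb_nonneg s π
  have hr1 := stayProb_le_one s π
  have hγr : γ * stayProb s π < 1 := by nlinarith
  have hterm (t : ℕ) : γ ^ t * ∑ y : Fin 2, ∑ a : A,
      (escapeMDP γ h0 h1 s).stateActionProb π (PMF.pure 1) t y a *
        (escapeMDP γ h0 h1 s).reward y a = γ ^ t - (γ * stayProb s π) ^ t := by
    have hrew (y : Fin 2) (a : A) :
        (escapeMDP γ h0 h1 s).reward y a = if y = 0 then 1 else 0 := by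
      fin_cases y <;> simp [LinearMDP.reward, escapeMDP, EuclideanSpace.inner_single_left]
    have h := toReal_add_toReal_eq_one ((escapeMDP γ h0 h1 s).stateLaw π (PMF.pure 1) t)
    rw [stateLaw_one] at h
    simp only [hrew, Fin.sum_univ_two, if_true, one_ne_zero, if_false, mul_one, mul_zero,
      Finset.sum_const_zero, add_zero, LinearMDP.stateActionProb, ← Finset.mul_sum,
      sum_toReal_eq_one]
    rw [mul_pow, eq_sub_of_add_eq h]
    ring
  have hval : (escapeMDP γ h0 h1 s).value π 1 = 1 / (1 - γ) - 1 / (1 - γ * stayProb s π) := by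
    have hs := (hasSum_geometric_of_lt_one h0.le h1).sub
      (hasSum_geometric_of_lt_one (mul_nonneg h0.le hr0) hγr)
    rw [one_div, one_div, ← hs.tsum_eq]
    exact tsum_congr hterm
  rw [LinearMDP.initialValue, Fin.sum_univ_two, hval]
  simp [escapeMDP]

/-- Under a constant action the state process sees only that action's escape rate, and the reward
features do not see the action. -/
lemma featureExpectation_pure_eq {s' : A → Set.Icc (0 : ℝ) 1} {a a' : A} (h : s a = s' a') :
    (escapeMDP γ h0 h1 s).featureExpectation (fun _ => PMF.pure a) =
      (escapeMDP γ h0 h1 s').featureExpectation fun _ => PMF.pure a' := by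
  classical
  have hlaw (t : ℕ) : (escapeMDP γ h0 h1 s).stateLaw (fun _ => PMF.pure a) (PMF.pure 1) t =
      (escapeMDP γ h0 h1 s').stateLaw (fun _ => PMF.pure a') (PMF.pure 1) t := by
    induction t with
    | zero => rfl
    | succ t ih =>
      rw [LinearMDP.stateLaw, LinearMDP.stateLaw, ih]
      congr 1
      ext1 x
      simp only [PMF.pure_bind, escapeMDP, escapeKernel, h]
  have hcollapse (s : A → Set.Icc (0 : ℝ) 1) (a : A) :
      (escapeMDP γ h0 h1 s).featureExpectation (fun _ => PMF.pure a) =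
        ∑ x : Fin 2, ((1 - γ) * ∑' t : ℕ, γ ^ t * ((escapeMDP γ h0 h1 s).stateLaw
          (fun _ => PMF.pure a) (PMF.pure 1) t x).toReal) • EuclideanSpace.single x (1 : ℝ) := by
    refine Finset.sum_congr rfl fun x _ => ?_
    rw [Finset.sum_eq_single a]
    · simp [LinearMDP.occupancy, LinearMDP.stateActionProb, escapeMDP]
    · intro b _ hb
      simp [LinearMDP.occupancy, LinearMDP.stateActionProb, PMF.pure_apply, hb]
    · simp
  simp only [hcollapse, hlaw]

end Value

/-! ### Suboptimality and information bounds for the hard family -/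

section Instances

variable {γ δ : ℝ} {h0 : 0 < γ} {h1 : γ < 1} {hδ : δ ∈ Set.Icc (0 : ℝ) 1}

lemma stayProb_escapeRate (a : A) (π : Policy (Fin 2) A) :
    stayProb (escapeRate γ δ h0 h1 hδ (some a)) π =
      1 - (1 - γ) / 4 * (1 + δ * (π 1 a).toReal) := by
  classical
  have hterm (b : A) : (π 1 b).toReal * (1 - (escapeRate γ δ h0 h1 hδ (some a) b : ℝ)) =
      (1 - (1 - γ) / 4) * (π 1 b).toReal -
        if a = b then (1 - γ) / 4 * δ * (π 1 b).toReal else 0 := by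
    simp only [escapeRate, Option.some.injEq]
    split_ifs <;> ring
  rw [stayProb]
  simp only [hterm, Finset.sum_sub_distrib, ← Finset.mul_sum, sum_toReal_eq_one,
    Finset.sum_ite_eq, Finset.mem_univ, if_true]
  ring

/-- The value denominators are `1 - γ` times factors in `[1, 3 / 2]`, so the constant is `4 * (3 /
2) ^ 2 = 9`. The upper bound serves integrability. -/
lemma suboptimality_escapeMDP_bounds (a : A) (π : Policy (Fin 2) A) :
    let M := escapeMDP γ h0 h1 (escapeRate γ δ h0 h1 hδ (some a))
    γ * δ / (9 * (1 - γ)) * (1 - (π 1 a).toReal) ≤ M.suboptimality (fun _ => PMF.pure a) π ∧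
      M.suboptimality (fun _ => PMF.pure a) π ≤ 1 / (1 - γ) := by
  classical
  intro M
  obtain ⟨hd0, hd1⟩ := id hδ
  have hq0 : 0 ≤ (π 1 a).toReal := ENNReal.toReal_nonneg
  have hq1 : (π 1 a).toReal ≤ 1 :=
    ENNReal.toReal_le_of_le_ofReal zero_le_one (by simpa using (π 1).coe_le_one a)
  set q := (π 1 a).toReal with hq
  have hg : 0 < 1 - γ := by linarith
  have hsub : M.suboptimality (fun _ => PMF.pure a) π =
      1 / (1 - γ * (1 - (1 - γ) / 4 * (1 + δ * q))) -
        1 / (1 - γ * (1 - (1 - γ) / 4 * (1 + δ))) := by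
    rw [LinearMDP.suboptimality, initialValue_escapeMDP, initialValue_escapeMDP,
      stayProb_escapeRate, stayProb_escapeRate, ← hq]
    simp
  have e1 (r : ℝ) : 1 - γ * (1 - (1 - γ) / 4 * (1 + r)) = (1 - γ) * (1 + γ * (1 + r) / 4) := by
    ring
  rw [hsub, e1, e1]
  have hdq : δ * q ≤ δ := mul_le_of_le_one_right hd0 hq1
  have hdq0 : 0 ≤ δ * q := mul_nonneg hd0 hq0
  have b1 : 1 ≤ 1 + γ * (1 + δ * q) / 4 := by
    have : 0 ≤ γ * (1 + δ * q) := by positivity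
    linarith
  have b2 : 1 ≤ 1 + γ * (1 + δ) / 4 := by
    have : 0 ≤ γ * (1 + δ) := by positivity
    linarith
  have b3 : 1 + γ * (1 + δ * q) / 4 ≤ 3 / 2 := by nlinarith
  have b4 : 1 + γ * (1 + δ) / 4 ≤ 3 / 2 := by nlinarith
  constructor
  · have hdiff : 1 / ((1 - γ) * (1 + γ * (1 + δ * q) / 4)) -
        1 / ((1 - γ) * (1 + γ * (1 + δ) / 4)) =
        γ * δ * (1 - q) / (4 * (1 - γ) * ((1 + γ * (1 + δ * q) / 4) * (1 + γ * (1 + δ) / 4))) := by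
      field_simp
      ring
    rw [hdiff, div_mul_eq_mul_div]
    have hnum : 0 ≤ γ * δ * (1 - q) := mul_nonneg (mul_nonneg h0.le hd0) (by linarith)
    refine div_le_div_of_nonneg_left hnum (by positivity) ?_
    have : (1 + γ * (1 + δ * q) / 4) * (1 + γ * (1 + δ) / 4) ≤ 3 / 2 * (3 / 2) :=
      mul_le_mul b3 b4 (by linarith) (by norm_num)
    nlinarith
  · have h2 : 0 ≤ 1 / ((1 - γ) * (1 + γ * (1 + δ) / 4)) := by positivity
    have h3 : 1 / ((1 - γ) * (1 + γ * (1 + δ * q) / 4)) ≤ 1 / (1 - γ) :=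
      one_div_le_one_div_of_le hg (le_mul_of_one_le_right hg.le b1)
    linarith

/-- For a fixed action rule, the expected masses that an output puts on the distinguished actions
of the respective environments have average at most `3 / 4` if there are few trajectories. -/
lemma sum_expect_le_of_few_trajectories (hcard : 2 ≤ Fintype.card A) {k : ℕ}
    (hk : 32 * δ ^ 2 * k ≤ Fintype.card A)
    (act : List (Trajectory (Fin 2) A) → Trajectory (Fin 2) A → Fin 2 → A)
    (out : List (Trajectory (Fin 2) A) → Policy (Fin 2) A) :
    ∑ a : A, expect ((escapeMDP γ h0 h1 (escapeRate γ δ h0 h1 hδ (some a))).dataset act k)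
      (fun D => out D 1 a) ≤ ENNReal.ofReal (3 / 4 * Fintype.card A) := by
  classical
  obtain ⟨hd0, hd1⟩ := id hδ
  set M := escapeMDP γ h0 h1 (escapeRate (A := A) γ δ h0 h1 hδ none)
  set p := (1 - γ) / 4 with hp
  have hp0 : 0 < p := by rw [hp]; linarith
  have hp1 : p ≤ 1 / 4 := by rw [hp]; linarith
  have hpd : p * δ ≤ 1 / 4 := by nlinarith
  have hlen : expect (M.dataset act k) (dataSum fun _ => (1 : ℝ≥0∞)) =
      ENNReal.ofReal (k / (1 - γ)) := by
    rw [M.expect_dataset_length act k, show M.γ = γ from rfl, ← ENNReal.ofReal_natCast,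
      ← ENNReal.ofReal_mul (Nat.cast_nonneg k), mul_one_div]
  -- An upper bound for the relative entropy of one trial of `a` in state `1`.
  let w (a : A) (tr : Transition (Fin 2) A) : ℝ≥0∞ :=
    if tr.1 = 1 ∧ tr.2.1 = a then ENNReal.ofReal (2 * p * δ ^ 2) else 0
  have hone (a : A) : expect
      ((escapeMDP γ h0 h1 (escapeRate γ δ h0 h1 hδ (some a))).dataset act k)
      (fun D => out D 1 a) ≤ expect (M.dataset act k) (fun D => out D 1 a) + 1 / 8 +
        8 * expect (M.dataset act k) (dataSum (w a)) := by
    let R (tr : Transition (Fin 2) A) : ℝ≥0∞ :=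
      if tr.1 = 1 ∧ tr.2.1 = a then
        if tr.2.2 = 0 then ENNReal.ofReal (1 + δ)
        else ENNReal.ofReal ((1 - p - p * δ) / (1 - p))
      else 1
    -- The values of `u` and `-v` come from `log x ≥ 1 - 1 / x` applied to the two likelihood ratios
    -- in `R`.
    let u (tr : Transition (Fin 2) A) : ℝ≥0 :=
      if tr.1 = 1 ∧ tr.2.1 = a ∧ tr.2.2 = 0 then (δ / (1 + δ)).toNNReal else 0
    let v (tr : Transition (Fin 2) A) : ℝ≥0 :=
      if tr.1 = 1 ∧ tr.2.1 = a ∧ tr.2.2 = 1 then (p * δ / (1 - p - p * δ)).toNNReal else 0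
    have hu0 : 0 ≤ δ / (1 + δ) := by positivity
    have hv0 : 0 ≤ p * δ / (1 - p - p * δ) := div_nonneg (by positivity) (by linarith)
    have hu1 (tr : Transition (Fin 2) A) : (u tr : ℝ≥0∞) ≤ 1 := by
      simp only [u]
      split_ifs
      · norm_cast
        rw [Real.toNNReal_le_one]
        exact div_le_one_of_le₀ (by linarith) (by linarith)
      · simp
    refine LinearMDP.expect_dataset_le_add (M := M)
      (M' := escapeMDP γ h0 h1 (escapeRate γ δ h0 h1 hδ (some a)))
      (R := R) (u := u) (v := v) (w := w a) rfl rfl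
      ?_ ?_ ?_ ?_ act k ?_ fun D => (out D 1).coe_le_one a
    · intro x b y
      fin_cases x
      · simp [M, escapeMDP, escapeKernel, R]
      · by_cases hb : b = a
        · subst hb
          fin_cases y
          · simp only [Fin.mk_one, Fin.zero_eta, M, R, escapeMDP_P_one_zero, escapeRate_none,
              escapeRate_some_self, ← hp, and_self, if_true]
            rw [← ENNReal.ofReal_mul hp0.le]
          · simp only [Fin.mk_one, M, R, escapeMDP_P_one_one, escapeRate_none,
              escapeRate_some_self, ← hp, and_self, if_true, one_ne_zero, if_false]
            rw [← ENNReal.ofReal_mul (by linarith)]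
            congr 1
            field_simp [show 1 - p ≠ 0 by linarith]
            ring
        · fin_cases y <;>
            simp [M, R, hb, escapeMDP_P_one_zero, escapeMDP_P_one_one, escapeRate_none,
              escapeRate_some_of_ne hb]
    · rintro ⟨x, b, y⟩
      simp only [R, u, v]
      by_cases hxb : x = 1 ∧ b = a
      · obtain ⟨rfl, rfl⟩ := hxb
        fin_cases y
        · simp only [Fin.zero_eta, Fin.isValue, and_self, if_true, zero_ne_one,
            and_false, if_false, NNReal.coe_zero, sub_zero]
          rw [Real.coe_toNNReal _ hu0]
          apply ENNReal.ofReal_le_ofReal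
          rw [← Real.le_log_iff_exp_le (by linarith)]
          refine le_trans (le_of_eq ?_) (Real.one_sub_inv_le_log_of_pos (by linarith))
          field_simp
          ring
        · simp only [Fin.mk_one, Fin.isValue, and_self, if_true, one_ne_zero,
            and_false, if_false, NNReal.coe_zero, zero_sub]
          rw [Real.coe_toNNReal _ hv0]
          apply ENNReal.ofReal_le_ofReal
          have h1p : 0 < 1 - p := by linarith
          have h2p : 0 < 1 - p - p * δ := by linarith
          have hpos : 0 < (1 - p - p * δ) / (1 - p) := div_pos h2p h1p
          rw [← Real.le_log_iff_exp_le hpos]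
          refine le_trans (le_of_eq ?_) (Real.one_sub_inv_le_log_of_pos hpos)
          field_simp
          ring
      · have h3 (c : Fin 2) : ¬(x = 1 ∧ b = a ∧ y = c) := fun h => hxb ⟨h.1, h.2.1⟩
        simp [hxb, h3]
    · intro x b
      by_cases hxb : x = 1 ∧ b = a
      · obtain ⟨rfl, rfl⟩ := hxb
        rw [expect_fin_two, expect_fin_two]
        simp only [M, u, v, w, escapeMDP_P_one_zero, escapeMDP_P_one_one, escapeRate_none, ← hp,
          one_ne_zero, zero_ne_one, if_false, and_self, and_false, if_true, ENNReal.coe_zero,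
          mul_zero, zero_add]
        change ENNReal.ofReal (1 - p) * ENNReal.ofReal _ ≤
          ENNReal.ofReal p * (ENNReal.ofReal _ + _) + _
        rw [← ENNReal.ofReal_add hu0 (by positivity), ← ENNReal.ofReal_mul (by linarith),
          ← ENNReal.ofReal_mul (by linarith), ← ENNReal.ofReal_mul (by linarith),
          ← ENNReal.ofReal_add (by positivity) (mul_nonneg (by linarith) (by positivity))]
        apply ENNReal.ofReal_le_ofReal
        have h2p : 0 < 1 - p - p * δ := by linarith
        -- The first-order terms in `δ` cancel; the remaining denominator is at least `1 / 2`.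
        have e : (1 - p) * (p * δ / (1 - p - p * δ)) - p * (δ / (1 + δ)) =
            p * δ ^ 2 / ((1 - p - p * δ) * (1 + δ)) := by
          field_simp
          ring
        have e' : p * δ ^ 2 / ((1 - p - p * δ) * (1 + δ)) ≤ 2 * p * δ ^ 2 := by
          rw [div_le_iff₀ (by positivity)]
          have : 1 / 2 ≤ (1 - p - p * δ) * (1 + δ) := by nlinarith
          have : 0 ≤ p * δ ^ 2 := by positivity
          nlinarith
        linarith
      · have h3 (y c : Fin 2) : ¬(x = 1 ∧ b = a ∧ y = c) := fun h => hxb ⟨h.1, h.2.1⟩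
        simp [v, h3, expect]
    · intro x b
      rw [expect_fin_two]
      have hw (tr : Transition (Fin 2) A) : w a tr ≠ ∞ := by
        simp only [w]
        split_ifs <;> simp
      have hP (y : Fin 2) := (M.P x b).apply_ne_top y
      exact ENNReal.add_ne_top.2
        ⟨ENNReal.mul_ne_top (hP 0) (ENNReal.add_ne_top.2 ⟨ENNReal.coe_ne_top, hw _⟩),
          ENNReal.mul_ne_top (hP 1) (ENNReal.add_ne_top.2 ⟨ENNReal.coe_ne_top, hw _⟩)⟩
    · refine ne_top_of_le_ne_top (b := expect (M.dataset act k) (dataSum fun _ => (1 : ℝ≥0∞)))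
        (by rw [hlen]; exact ENNReal.ofReal_ne_top) (expect_mono _ fun D => ?_)
      simpa using sum_dataSum_le (Finset.univ : Finset Unit)
        (g := fun _ tr => (u tr : ℝ≥0∞)) (c := 1) (by simpa using hu1) D
  -- A transition tries only one action, so the information summed over all hypotheses does not grow
  -- with `|A|`.
  have hw (tr : Transition (Fin 2) A) :
      ∑ a, w a tr ≤ ENNReal.ofReal (2 * p * δ ^ 2) := by
    by_cases hx : tr.1 = 1 <;> simp [w, hx]
  have hwsum : ∑ a, expect (M.dataset act k) (dataSum (w a)) ≤
      ENNReal.ofReal (2 * p * δ ^ 2 * (k / (1 - γ))) := by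
    rw [← expect_sum, ENNReal.ofReal_mul (by positivity), ← hlen, ← expect_const_mul]
    exact expect_mono _ fun D => sum_dataSum_le _ hw D
  have hmass : ∑ a, expect (M.dataset act k) (fun D => out D 1 a) = 1 := by
    rw [← expect_sum]
    have (D : List (Trajectory (Fin 2) A)) : ∑ a, out D 1 a = 1 := by
      rw [← tsum_fintype (L := .unconditional A), PMF.tsum_coe]
    simp only [this, expect_const]
  calc _ ≤ ∑ a : A, (expect (M.dataset act k) (fun D => out D 1 a) + 1 / 8 +
        8 * expect (M.dataset act k) (dataSum (w a))) := Finset.sum_le_sum fun a _ => hone a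
    _ = 1 + Fintype.card A * (1 / 8) + 8 * ∑ a, expect (M.dataset act k) (dataSum (w a)) := by
      rw [Finset.sum_add_distrib, Finset.sum_add_distrib, hmass, ← Finset.mul_sum]
      simp
    _ ≤ 1 + Fintype.card A * (1 / 8) + 8 * ENNReal.ofReal (2 * p * δ ^ 2 * (k / (1 - γ))) := by
      gcongr
    _ = ENNReal.ofReal (1 + Fintype.card A * (1 / 8) + 8 * (2 * p * δ ^ 2 * (k / (1 - γ)))) := by
      have hg : 0 < 1 - γ := by linarith
      rw [ENNReal.ofReal_add (by positivity) (by positivity),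
        ENNReal.ofReal_add (by positivity) (by positivity), ENNReal.ofReal_mul (Nat.cast_nonneg _),
        ENNReal.ofReal_mul (p := 8) (by positivity), ENNReal.ofReal_natCast,
        ENNReal.ofReal_div_of_pos (by norm_num)]
      simp
    _ ≤ _ := by
      apply ENNReal.ofReal_le_ofReal
      have hg : 1 - γ ≠ 0 := by linarith
      have e : 8 * (2 * p * δ ^ 2 * (k / (1 - γ))) = 4 * δ ^ 2 * k := by
        rw [hp]
        field_simp
        ring
      rw [e]
      -- The three terms are at most `|A| / 2`, `|A| / 8` and `|A| / 8`.
      have : (2 : ℝ) ≤ Fintype.card A := by exact_mod_cast hcard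
      linarith

end Instances

/-! ### Averaging over environments and seeds -/

section Minimax

variable {A : Type*} [Fintype A] {γ δ : ℝ} {h0 : 0 < γ} {h1 : γ < 1}
  {hδ : δ ∈ Set.Icc (0 : ℝ) 1}

lemma learnerInput_escapeMDP_eq (a a' : A) :
    (escapeMDP γ h0 h1 (escapeRate γ δ h0 h1 hδ (some a))).learnerInput 1
        (fun _ => PMF.pure a) =
      (escapeMDP γ h0 h1 (escapeRate γ δ h0 h1 hδ (some a'))).learnerInput 1
        fun _ => PMF.pure a' := by
  have h : escapeRate γ δ h0 h1 hδ (some a) a = escapeRate γ δ h0 h1 hδ (some a') a' := by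
    simp [escapeRate]
  simp only [LinearMDP.learnerInput, featureExpectation_pure_eq h]
  rfl

/-- Nonnegativity, boundedness and measurability turn the Bochner integral into a lower Lebesgue
integral, where the calculus of `expect` applies. -/
lemma ofReal_expectedSuboptimality {X : Type*} [Fintype X] {dr dP : ℕ}
    (M : LinearMDP X A dr dP) {Ω : Type*} [MeasurableSpace Ω] (alg : Algorithm Ω X A dr dP)
    (W B : ℝ) (k : ℕ) (πE : Policy X A) (hM0 : ∀ π, 0 ≤ M.suboptimality πE π)
    (hMB : ∀ π, M.suboptimality πE π ≤ B)
    (hmeas : ∀ D, Measurable fun ω =>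
      M.suboptimality πE (alg.out (M.learnerInput W πE) ω D)) :
    ENNReal.ofReal (M.expectedSuboptimality alg W k πE) =
      ∫⁻ ω, expect (M.dataset (alg.act (M.learnerInput W πE) ω) k) (fun D =>
        ENNReal.ofReal (M.suboptimality πE (alg.out (M.learnerInput W πE) ω D))) ∂alg.seed := by
  have := alg.isProbabilityMeasure_seed
  set I := M.learnerInput W πE with hI
  have hle (ω : Ω) : expect (M.dataset (alg.act I ω) k) (fun D =>
      ENNReal.ofReal (M.suboptimality πE (alg.out I ω D))) ≤ ENNReal.ofReal B := by
    conv_rhs => rw [← expect_const (M.dataset (alg.act I ω) k) (ENNReal.ofReal B)]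
    exact expect_mono _ fun D => ENNReal.ofReal_le_ofReal (hMB _)
  have hinner (ω : Ω) : ∑' D, (M.dataset (alg.act I ω) k D).toReal *
      M.suboptimality πE (alg.out I ω D) = (expect (M.dataset (alg.act I ω) k) fun D =>
        ENNReal.ofReal (M.suboptimality πE (alg.out I ω D))).toReal := by
    rw [expect, ENNReal.tsum_toReal_eq fun D =>
      ENNReal.mul_ne_top (PMF.apply_ne_top _ D) ENNReal.ofReal_ne_top]
    refine tsum_congr fun D => ?_
    rw [ENNReal.toReal_mul, ENNReal.toReal_ofReal (hM0 _)]
  rw [LinearMDP.expectedSuboptimality]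
  simp only [← hI, hinner]
  rw [integral_toReal, ENNReal.ofReal_toReal]
  · exact ((lintegral_mono hle).trans_lt (by simp)).ne
  · exact (M.measurable_expect_dataset (fun D h x a => alg.measurableSet_act I D h x a)
      (fun D => (hmeas D).ennreal_ofReal) k).aemeasurable
  · exact Filter.Eventually.of_forall fun ω => (hle ω).trans_lt ENNReal.ofReal_lt_top

/-- With few trajectories, every algorithm misses the distinguished action in some environment. -/
lemma exists_le_expectedSuboptimality (hcard : 2 ≤ Fintype.card A) {k : ℕ}
    (hk : 32 * δ ^ 2 * k ≤ Fintype.card A) {Ω : Type*} [MeasurableSpace Ω]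
    (alg : Algorithm Ω (Fin 2) A 2 (2 * Fintype.card A)) :
    ∃ a : A, γ * δ / (36 * (1 - γ)) ≤
      (escapeMDP γ h0 h1 (escapeRate γ δ h0 h1 hδ (some a))).expectedSuboptimality alg 1 k
        fun _ => PMF.pure a := by
  have := alg.isProbabilityMeasure_seed
  have hne : Nonempty A := Fintype.card_pos_iff.1 (by omega)
  obtain ⟨a₀⟩ := hne
  let M (a : A) := escapeMDP γ h0 h1 (escapeRate γ δ h0 h1 hδ (some a))
  let πE (a : A) : Policy (Fin 2) A := fun _ => PMF.pure a
  set I := (M a₀).learnerInput 1 (πE a₀) with hI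
  have hIa (a : A) : (M a).learnerInput 1 (πE a) = I := learnerInput_escapeMDP_eq a a₀
  have hg : 0 < 1 - γ := by linarith
  let Q (a : A) (ω : Ω) : ℝ≥0∞ :=
    expect ((M a).dataset (alg.act I ω) k) fun D => alg.out I ω D 1 a
  have hQm (a : A) : Measurable (Q a) :=
    (M a).measurable_expect_dataset (fun D h x a => alg.measurableSet_act I D h x a)
      (fun D => alg.measurable_out I D 1 a) k
  have hsum : ∑ a, ∫⁻ ω, Q a ω ∂alg.seed ≤ ∑ _a : A, ENNReal.ofReal (3 / 4) := by
    rw [← lintegral_finsetSum _ fun a _ => hQm a]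
    calc _ ≤ ∫⁻ _, ENNReal.ofReal (3 / 4 * Fintype.card A) ∂alg.seed :=
          lintegral_mono fun ω => sum_expect_le_of_few_trajectories hcard hk (alg.act I ω)
            (alg.out I ω)
      _ = _ := by
        rw [lintegral_const, measure_univ, mul_one, mul_comm,
          ENNReal.ofReal_mul (Nat.cast_nonneg _), ENNReal.ofReal_natCast]
        simp
  -- Pigeonhole: some action's mass is at most the average.
  obtain ⟨a, ha⟩ : ∃ a, ∫⁻ ω, Q a ω ∂alg.seed ≤ ENNReal.ofReal (3 / 4) := by
    by_contra! h
    exact hsum.not_gt (ENNReal.sum_lt_sum_of_nonempty ⟨a₀, Finset.mem_univ _⟩ fun a _ => h a)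
  refine ⟨a, ?_⟩
  have hb (π : Policy (Fin 2) A) := suboptimality_escapeMDP_bounds (h0 := h0) (h1 := h1)
    (hδ := hδ) a π
  have hc : 0 ≤ γ * δ / (9 * (1 - γ)) := div_nonneg (mul_nonneg h0.le hδ.1) (by linarith)
  have hq (π : Policy (Fin 2) A) : (π 1 a).toReal ≤ 1 :=
    ENNReal.toReal_le_of_le_ofReal zero_le_one (by simpa using (π 1).coe_le_one a)
  have hpos (π : Policy (Fin 2) A) : 0 ≤ (M a).suboptimality (πE a) π :=
    (mul_nonneg hc (by linarith [hq π])).trans (hb π).1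
  have hmeas (D : List (Trajectory (Fin 2) A)) : Measurable fun ω =>
      (M a).suboptimality (πE a) (alg.out ((M a).learnerInput 1 (πE a)) ω D) := by
    rw [hIa]
    simp only [LinearMDP.suboptimality, M, initialValue_escapeMDP, stayProb_escapeRate]
    have := (alg.measurable_out I D 1 a).ennreal_toReal
    fun_prop
  have hE := ofReal_expectedSuboptimality (M a) alg 1 (1 / (1 - γ)) k (πE a) hpos
    (fun π => (hb π).2) hmeas
  rw [hIa] at hE
  set c := γ * δ / (9 * (1 - γ)) with hcdef
  -- The loss is at least `c` times the missing mass. With mass at most `3 / 4` this leaves `c / 4`,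
  -- hence the constant `36`.
  have hpoint (ω : Ω) : ENNReal.ofReal c ≤
      expect ((M a).dataset (alg.act I ω) k) (fun D =>
        ENNReal.ofReal ((M a).suboptimality (πE a) (alg.out I ω D))) +
      ENNReal.ofReal c * Q a ω := by
    rw [← expect_const_mul, ← expect_add]
    conv_lhs => rw [← expect_const ((M a).dataset (alg.act I ω) k) (ENNReal.ofReal c)]
    refine expect_mono _ fun D => ?_
    rw [← ENNReal.ofReal_toReal ((alg.out I ω D 1).apply_ne_top a), ← ENNReal.ofReal_mul hc,
      ← ENNReal.ofReal_add (hpos _) (mul_nonneg hc ENNReal.toReal_nonneg)]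
    apply ENNReal.ofReal_le_ofReal
    have := (hb (alg.out I ω D)).1
    change c * _ ≤ (M a).suboptimality (πE a) _ at this
    linarith
  have hint := lintegral_mono (μ := alg.seed) hpoint
  rw [lintegral_const, measure_univ, mul_one, lintegral_add_right _ ((hQm a).const_mul _),
    lintegral_const_mul _ (hQm a), ← hE] at hint
  replace hint := hint.trans (add_le_add_right (mul_le_mul_right ha _) _)
  rw [← ENNReal.ofReal_mul hc] at hint
  set E := (M a).expectedSuboptimality alg 1 k (πE a) with hEdef
  have hE0 : 0 ≤ E := integral_nonneg fun ω => tsum_nonneg fun D =>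
    mul_nonneg ENNReal.toReal_nonneg (hpos _)
  rw [← ENNReal.ofReal_add hE0 (by positivity),
    ENNReal.ofReal_le_ofReal_iff (by positivity)] at hint
  have : γ * δ / (36 * (1 - γ)) = c / 4 := by
    rw [hcdef]
    field_simp
    ring
  change _ ≤ E
  rw [this]
  linarith

end Minimax

end

end FeatureImitation

/-! ### Choice of constants -/

theorem mainTheorem4 (γ₀ : ℝ) (hγ₀ : 0 < γ₀) (C : ℝ) (hC : 0 < C) :
    ∃ c > (0 : ℝ), ∃ ε₀ > (0 : ℝ),
      ∀ (A : Type*) [Fintype A], 2 ≤ Fintype.card A →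
      ∀ γ : ℝ, γ₀ ≤ γ → γ < 1 →
      ∀ ε : ℝ, 0 < ε → ε ≤ ε₀ / (1 - γ) →
      ∀ K : ℕ,
      ∀ (Ω : Type*) [MeasurableSpace Ω]
        (alg : FeatureImitation.Algorithm Ω (Fin 2) A 2 (2 * Fintype.card A)),
      (K : ℝ) < c * (2 + 2 * (Fintype.card A : ℝ)) / ((1 - γ) ^ 2 * ε ^ 2) →
      ∃ (M : FeatureImitation.LinearMDP (Fin 2) A 2 (2 * Fintype.card A))
        (πE : FeatureImitation.Policy (Fin 2) A),
        M.γ = γ ∧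
        (∀ x a, M.φr x a = EuclideanSpace.single x 1) ∧
        (∀ x a, ‖M.φP x a‖ ≤ 1) ∧
        ‖M.w‖ ≤ 1 ∧
        C * ε < M.expectedSuboptimality alg 1 K πE := by
  -- Taking `37` rather than `36` makes the final inequality strict.
  set κ := 37 * C / γ₀ with hκ
  have hκ0 : 0 < κ := by positivity
  -- Here `96 = 3 * 32`, because `2 + 2 * |A| ≤ 3 * |A|`; and `ε₀ = 1 / κ` ensures that `δ = κ * ε *
  -- (1 - γ)` is at most one.
  refine ⟨1 / (96 * κ ^ 2), by positivity, 1 / κ, by positivity, ?_⟩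
  intro A _ hcard γ hγ hγ1 ε hε hε₀ K Ω _ alg hK
  have hγ0 : 0 < γ := hγ₀.trans_le hγ
  have hg : 0 < 1 - γ := by linarith
  have hδ : κ * ε * (1 - γ) ∈ Set.Icc (0 : ℝ) 1 := by
    refine ⟨by positivity, ?_⟩
    rw [le_div_iff₀ hg, le_div_iff₀ hκ0] at hε₀
    linarith
  have hcard' : (2 : ℝ) ≤ Fintype.card A := by exact_mod_cast hcard
  have hk : 32 * (κ * ε * (1 - γ)) ^ 2 * K ≤ Fintype.card A := by
    rw [lt_div_iff₀ (by positivity), div_mul_eq_mul_div, lt_div_iff₀ (by positivity)] at hK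
    have : 32 * (κ * ε * (1 - γ)) ^ 2 * K = (K * ((1 - γ) ^ 2 * ε ^ 2) * (96 * κ ^ 2)) / 3 := by
      ring
    linarith
  obtain ⟨a, ha⟩ := FeatureImitation.exists_le_expectedSuboptimality (h0 := hγ0) (h1 := hγ1)
    (hδ := hδ) hcard hk alg
  refine ⟨_, _, rfl, fun _ _ => rfl, fun x b => ?_, ?_, lt_of_lt_of_le ?_ ha⟩
  · simp [FeatureImitation.escapeMDP]
  · simp [FeatureImitation.escapeMDP]
  · have h : γ * (κ * ε * (1 - γ)) / (36 * (1 - γ)) = γ * κ * ε / 36 := by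
      field_simp
    have h' : γ₀ * κ * ε = 37 * (C * ε) := by
      rw [hκ]
      field_simp
    have h'' : γ₀ * (κ * ε) ≤ γ * (κ * ε) := mul_le_mul_of_nonneg_right hγ (by positivity)
    have := mul_pos hC hε
    rw [h]
    linarith
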